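/- Let $R$ be a commutative noetherian ring, $\mathfrak a,\mathfrak b$ ideals of $R$, and $M$ a finitely generated $R$-module. Write $\mathcal V(\mathfrak a)$ for the set of prime ideals containing $\mathfrak a$. A sequence $x_1,\dots,x_n$ in $R$ is called an $\mathfrak a$-filter regular $M$-sequence if $$\mathrm{Supp}_R\left(\frac{(x_1,\dots,x_{i-1})M:_M x_i}{(x_1,\dots,x_{i-1})M}\right)\subseteq \mathcal V(\mathfrak a)\quad\text{for all } i=1,\dots,n,$$ and, for an ideal $\mathfrak c$ of $R$, $\mathrm{f\text{-}grad}_R(\mathfrak a,\mathfrak c,M)\in\mathbb N_0\cup\{\infty\}$ denotes the supremum of the lengths of all $\mathfrak a$-filter regular $M$-sequences whose terms lie in $\mathfrak c$. The module $M$ is called an $(\mathfrak a,\mathfrak b)$-f-module if $M\neq 0$, $\mathrm{Supp}_R(M/\mathfrak bM)\not\subseteq\mathcal V(\mathfrak a)$, and $$\mathrm{f\text{-}grad}_R(\mathfrak a,\mathfrak p,M)+\dim R/\mathfrak p=\dim_R M\quad\text{for all }\mathfrak p\in\mathrm{Supp}_R(M/\mathfrak bM)\setminus\mathcal V(\mathfrak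 a).$$ Proposition 3.3 (first, localizations). If $M$ is an $(\mathfrak a,\mathfrak b)$-f-module, then for every $\mathfrak p\in\mathrm{Supp}_R(M/\mathfrak bM)\setminus\mathcal V(\mathfrak a)$ the localization $M_{\mathfrak p}$ is a Cohen–Macaulay $R_{\mathfrak p}$-module, that is, a nonzero finitely generated $R_{\mathfrak p}$-module with $\mathrm{depth}_{R_{\mathfrak p}}M_{\mathfrak p}=\dim_{R_{\mathfrak p}}M_{\mathfrak p}$. -/

import Mathlib

namespace FilterGrade

/-- The submodule `(N :_M x) / N` of `M / N`, where `N :_M x = {m ∈ M | x m ∈ N}`. -/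
def colonQuotient {R M : Type*} [CommRing R] [AddCommGroup M] [Module R M]
    (N : Submodule R M) (x : R) : Submodule R (M ⧸ N) :=
  (N.comap (LinearMap.lsmul R M x)).map N.mkQ

/-- The sequence `x₁, …, xₙ` (given as the list `rs`) is an `𝔞`-filter regular `M`-sequence:
`Supp ((x₁, …, xᵢ₋₁)M :_M xᵢ / (x₁, …, xᵢ₋₁)M) ⊆ V(𝔞)` for all `i = 1, …, n`.
With the indexing from zero used here, `xᵢ₊₁ = rs[i]` and `(x₁, …, xᵢ) = (rs.take i)`. -/
def IsFilterRegular {R : Type*} [CommRing R] (a : Ideal R)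
    (M : Type*) [AddCommGroup M] [Module R M] (rs : List R) : Prop :=
  ∀ (i : ℕ) (h : i < rs.length),
    Module.support R
        (colonQuotient (Ideal.ofList (rs.take i) • (⊤ : Submodule R M)) rs[i]) ⊆
      PrimeSpectrum.zeroLocus (a : Set R)

/-- The `𝔞`-filter grade of `𝔟` on `M`: the supremum in `ℕ ∪ {∞}` of the lengths of all
`𝔞`-filter regular `M`-sequences in `𝔟`. For finitely generated modules over a noetherian ring
this is the common length of all maximal such sequences if `Supp (M/𝔟M) ⊄ V(𝔞)`, and `∞` if
`Supp (M/𝔟M) ⊆ V(𝔞)`. -/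
noncomputable def filterGrade {R : Type*} [CommRing R] (a b : Ideal R)
    (M : Type*) [AddCommGroup M] [Module R M] : ℕ∞ :=
  ⨆ (rs : List R) (_ : IsFilterRegular a M rs ∧ ∀ x ∈ rs, x ∈ b), (rs.length : ℕ∞)

/-- `M` is an `(𝔞, 𝔟)`-f-module: `M ≠ 0`, `Supp (M/𝔟M) ⊄ V(𝔞)`, and
`f-grad (𝔞, 𝔭, M) = dim M - dim R/𝔭` for all `𝔭 ∈ Supp (M/𝔟M) \ V(𝔞)`.
The last equality is written as `f-grad (𝔞, 𝔭, M) + dim R/𝔭 = dim M`, because a difference of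
two infinite dimensions would have no meaning. (Over a noetherian ring, some `𝔭` in the nonempty
set `Supp (M/𝔟M) \ V(𝔞)` has `dim R/𝔭 ≤ 1`, so that the equalities force `dim M < ∞`.) -/
structure IsFModule {R : Type*} [CommRing R] (a b : Ideal R)
    (M : Type*) [AddCommGroup M] [Module R M] : Prop where
  nontrivial : Nontrivial M
  not_support_subset :
    ¬ Module.support R (M ⧸ (b • ⊤ : Submodule R M)) ⊆ PrimeSpectrum.zeroLocus (a : Set R)
  grade_add_dim : ∀ p ∈ Module.support R (M ⧸ (b • ⊤ : Submodule R M)) \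
      PrimeSpectrum.zeroLocus (a : Set R),
    (filterGrade a p.asIdeal M : WithBot ℕ∞) + ringKrullDim (R ⧸ p.asIdeal) =
      Module.supportDim R M

/-- The depth of a module over a local ring: the supremum of the lengths of all
`M`-regular sequences in the maximal ideal. -/
noncomputable def localDepth (A : Type*) [CommRing A] [IsLocalRing A]
    (M : Type*) [AddCommGroup M] [Module A M] : ℕ∞ :=
  ⨆ (rs : List A) (_ : RingTheory.Sequence.IsRegular M rs ∧
    ∀ x ∈ rs, x ∈ IsLocalRing.maximalIdeal A), (rs.length : ℕ∞)

/-- A module over a noetherian local ring is Cohen–Macaulay: it is finitely generated and nonzero,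
and its depth equals its Krull dimension. -/
structure IsCohenMacaulay (A : Type*) [CommRing A] [IsNoetherianRing A] [IsLocalRing A]
    (M : Type*) [AddCommGroup M] [Module A M] : Prop where
  finite : Module.Finite A M
  nontrivial : Nontrivial M
  depth_eq_dim : (localDepth A M : WithBot ℕ∞) = Module.supportDim A M

end FilterGrade

/-!
Fix `p ∈ Supp (M/bM) \ V(a)`. The support condition on an `a`-filter regular `M`-sequence says that
the colon quotients vanish at every prime outside `V(a)`, in particular at `p`. Such a sequence with
terms in `p` therefore becomes a regular `M_p`-sequence, so that
`f-grad (a, p, M) ≤ depth M_p ≤ dim M_p` (`filterGrade_le_localDepth`, `localDepth_le_supportDim`).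
Concatenating chains of primes below and above `p` gives `dim M_p + dim R/p ≤ dim M`
(`supportDim_localizedModule_add_le`). As `dim M = f-grad (a, p, M) + dim R/p`, the term `dim R/p`
can be cancelled when it is finite, which yields `dim M_p ≤ f-grad (a, p, M)` and hence equality of
depth and dimension.

It remains to see that `dim M` is finite although `R` may have infinite Krull dimension
(`IsFModule.supportDim_ne_top`). For a maximal element `q` of `Supp (M/bM) \ V(a)`, some `x ∈ a`
avoids `q` and lies in every prime strictly above `q`. By Krull's principal ideal theorem and prime
avoidance, a noetherian domain with a nonzero element lying in all nonzero primes has dimension at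
most one, so `dim R/q ≤ 1`. The equation defining an f-module at `q` then bounds `dim M`, because
`f-grad (a, q, M) ≤ dim M_q < ∞`.
-/

namespace FilterGrade

open Module RingTheory.Sequence Order

variable {R : Type*} [CommRing R]

/-! ### Noetherian domains whose nonzero primes share a nonzero element -/

/-- A noetherian domain with a nonzero element `x` in all nonzero primes has dimension at most one:
the height-one primes are minimal over `(x)`, hence finite in number, and they cover every nonzero
prime. -/
theorem krullDimLE_one_of_mem_of_ne_bot [IsNoetherianRing R] [IsDomain R] {x : R} (hx0 : x ≠ 0)
    (hx : ∀ P : Ideal R, P.IsPrime → P ≠ ⊥ → x ∈ P) : Ring.KrullDimLE 1 R := by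
  have height_le {y : R} {q : Ideal R} (hq : q ∈ (Ideal.span {y}).minimalPrimes) :
      q.height ≤ 1 := Ideal.height_le_one_of_isPrincipal_of_mem_minimalPrimes _ _ hq
  have eq_of_le {P Q : Ideal R} (hP : P.IsPrime) (hQ : Q.IsPrime) (hP0 : P ≠ ⊥)
      (hQ1 : Q.height ≤ 1) (h : P ≤ Q) : P = Q := by
    by_contra hne
    have h1 : (1 : ℕ∞) ≤ P.height := by
      rw [Order.one_le_iff_ne_zero, Ne, Ideal.height_eq_zero_iff_eq_bot]
      exact hP0
    have h2 := Ideal.height_add_one_le_of_lt_of_isPrime (lt_of_le_of_ne h hne)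
    have h3 : (1 : ℕ∞) + 1 ≤ 1 := (add_le_add_left h1 1).trans (h2.trans hQ1)
    norm_num at h3
  have height_one_mem {Q : Ideal R} (hQ : Q.IsPrime) (hQ0 : Q ≠ ⊥) (hQ1 : Q.height ≤ 1) :
      Q ∈ (Ideal.span {x}).minimalPrimes := by
    obtain ⟨q, hq, hqQ⟩ := Ideal.exists_minimalPrimes_le
      ((Ideal.span_singleton_le_iff_mem Q).mpr (hx Q hQ hQ0))
    have hq0 : q ≠ ⊥ := fun h => hx0 <| by
      simpa [h] using hq.1.2 (Ideal.mem_span_singleton_self x)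
    exact eq_of_le hq.1.1 hQ hq0 hQ1 hqQ ▸ hq
  refine Ring.KrullDimLE.mk₁' fun I hI0 hI => ?_
  -- Prime avoidance: a nonzero prime is covered by the minimal primes of `(x)`, as each nonzero `y`
  -- in it lies in some minimal prime of `(y)`, which has height one.
  have mem_min {P : Ideal R} (hP : P.IsPrime) (hP0 : P ≠ ⊥) : P.height ≤ 1 := by
    have hsub : (P : Set R) ⊆ ⋃ q ∈ ((Ideal.finite_minimalPrimes_of_isNoetherianRing R
        (Ideal.span {x})).toFinset : Set (Ideal R)), (q : Set R) := by
      intro y hy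
      simp only [Set.Finite.coe_toFinset, Set.mem_iUnion, exists_prop]
      rcases eq_or_ne y 0 with rfl | hy0
      · obtain ⟨q, hq, -⟩ := Ideal.exists_minimalPrimes_le
          ((Ideal.span_singleton_le_iff_mem P).mpr (hx P hP hP0))
        exact ⟨q, hq, q.zero_mem⟩
      · obtain ⟨q, hq, -⟩ := Ideal.exists_minimalPrimes_le
          ((Ideal.span_singleton_le_iff_mem P).mpr hy)
        have hyq : y ∈ q := hq.1.2 (Ideal.mem_span_singleton_self y)
        exact ⟨q, height_one_mem hq.1.1 (fun h => hy0 (by simpa [h] using hyq)) (height_le hq),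
          hyq⟩
    obtain ⟨q, hq, hPq⟩ := (Ideal.subset_union_prime (f := fun q : Ideal R => q) ⊥ ⊥
      (fun q hq _ _ => ((Set.Finite.mem_toFinset _).mp hq).1.1)).mp hsub
    exact (Ideal.height_mono hPq).trans (height_le ((Set.Finite.mem_toFinset _).mp hq))
  obtain ⟨m, hm, hIm⟩ := Ideal.exists_le_maximal I hI.ne_top
  exact eq_of_le hI hm.isPrime hI0 (mem_min hm.isPrime fun h => hI0 (le_bot_iff.mp (h ▸ hIm))) hIm
    ▸ hm

theorem ringKrullDim_quotient_le_one [IsNoetherianRing R] {p : Ideal R} [p.IsPrime] {x : R}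
    (hxp : x ∉ p) (hx : ∀ q : Ideal R, q.IsPrime → p < q → x ∈ q) :
    ringKrullDim (R ⧸ p) ≤ 1 := by
  have h0 : Ideal.Quotient.mk p x ≠ 0 := fun h => hxp (Ideal.Quotient.eq_zero_iff_mem.mp h)
  have := krullDimLE_one_of_mem_of_ne_bot h0 fun P hP hP0 => by
    refine hx (P.comap (Ideal.Quotient.mk p)) inferInstance (lt_of_le_of_ne ?_ fun h => hP0 ?_)
    · intro y hy
      simp [Ideal.mem_comap, Ideal.Quotient.eq_zero_iff_mem.mpr hy]
    · rw [← Ideal.map_comap_of_surjective _ Ideal.Quotient.mk_surjective P, ← h]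
      exact Ideal.map_quotient_self p
  exact (Order.krullDimLE_iff _ _).mp this

variable {M : Type*} [AddCommGroup M] [Module R M]

/-! ### Localization of filter regular sequences -/

/-- Together with `mk_mem_smul_top`, this identifies `I • S⁻¹M` with the fractions whose numerator
can be chosen in `I • M`. -/
theorem exists_mk_eq_of_mem_smul_top (S : Submonoid R) (I : Ideal R) {z : LocalizedModule S M}
    (hz : z ∈ I • (⊤ : Submodule R (LocalizedModule S M))) :
    ∃ n ∈ I • (⊤ : Submodule R M), ∃ t : S, z = LocalizedModule.mk n t := by
  induction hz using Submodule.smul_induction_on' with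
  | smul r hr y _ =>
    induction y using LocalizedModule.induction_on with
    | h m s => exact ⟨r • m, Submodule.smul_mem_smul hr trivial, s, LocalizedModule.smul'_mk ..⟩
  | add y _ z _ hy hz =>
    obtain ⟨m, hm, s, rfl⟩ := hy
    obtain ⟨n, hn, t, rfl⟩ := hz
    exact ⟨t • m + s • n, add_mem (Submodule.smul_mem _ _ hm) (Submodule.smul_mem _ _ hn), s * t,
      LocalizedModule.mk_add_mk⟩

theorem mk_mem_smul_top (S : Submonoid R) (I : Ideal R) {n : M}
    (hn : n ∈ I • (⊤ : Submodule R M)) (t : S) :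
    LocalizedModule.mk n t ∈ I • (⊤ : Submodule R (LocalizedModule S M)) := by
  induction hn using Submodule.smul_induction_on' with
  | smul r hr m _ =>
    rw [← LocalizedModule.smul'_mk]
    exact Submodule.smul_mem_smul hr trivial
  | add y _ z _ hy hz =>
    have : LocalizedModule.mk (y + z) t = LocalizedModule.mk y t + LocalizedModule.mk z t := by
      rw [LocalizedModule.mk_add_mk, ← smul_add, LocalizedModule.mk_cancel_common_left]
    exact this ▸ add_mem hy hz

/-- Outside `V(a)` the obstruction to regularity vanishes, so an `a`-filter regular sequence becomes
weakly regular after localization there. -/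
theorem IsFilterRegular.isWeaklyRegular_localizedModule {a : Ideal R} {rs : List R}
    (h : IsFilterRegular a M rs) {p : PrimeSpectrum R}
    (hp : p ∉ PrimeSpectrum.zeroLocus (a : Set R)) :
    IsWeaklyRegular (LocalizedModule p.asIdeal.primeCompl M) rs := by
  refine ⟨fun i hi => ?_⟩
  rw [isSMulRegular_quotient_iff_mem_of_smul_mem]
  intro z hz
  induction z using LocalizedModule.induction_on with
  | h m s =>
  obtain ⟨n, hn, t, ht⟩ := exists_mk_eq_of_mem_smul_top _ _ hz
  rw [LocalizedModule.smul'_mk, LocalizedModule.mk_eq] at ht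
  obtain ⟨u, hu⟩ := ht
  have hmem : rs[i] • (u * t) • m ∈ Ideal.ofList (rs.take i) • (⊤ : Submodule R M) := by
    have : rs[i] • (u * t) • m = u • s • n := by
      rw [← hu, mul_smul, smul_comm rs[i] u, smul_comm rs[i] t]
    rw [this]
    exact Submodule.smul_mem _ _ (Submodule.smul_mem _ _ hn)
  obtain ⟨v, hv, hv0⟩ := Module.notMem_support_iff'.mp (fun hps => hp (h i hi hps))
    ⟨_, Submodule.mem_map_of_mem (f := Submodule.mkQ _) (r := (u * t) • m) hmem⟩
  have hv0' : v • (u * t) • m ∈ Ideal.ofList (rs.take i) • (⊤ : Submodule R M) :=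
    (Submodule.Quotient.mk_eq_zero _).mp (congrArg Subtype.val hv0)
  rw [← LocalizedModule.mk_cancel_common_left (⟨v, hv⟩ * (u * t)) s m, mul_smul]
  exact mk_mem_smul_top _ _ hv0' _

/-! ### Comparison of grade, depth and dimension -/

theorem localDepth_le_supportDim (A N : Type*) [CommRing A] [IsNoetherianRing A] [IsLocalRing A]
    [AddCommGroup N] [Module A N] [Module.Finite A N] [Nontrivial N] :
    (localDepth A N : WithBot ℕ∞) ≤ supportDim A N := by
  obtain ⟨d, hd⟩ := WithBot.ne_bot_iff_exists.mp (supportDim_ne_bot_of_nontrivial A N)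
  rw [← hd, WithBot.coe_le_coe, localDepth]
  refine iSup₂_le fun rs hrs => ?_
  have := hrs.1.quot_ofList_smul_nontrivial ⊤
  rw [← WithBot.coe_le_coe, hd, ← supportDim_add_length_eq_supportDim_of_isRegular rs hrs.1]
  obtain ⟨c, hc⟩ := WithBot.ne_bot_iff_exists.mp
    (supportDim_ne_bot_of_nontrivial A (N ⧸ (Ideal.ofList rs • ⊤ : Submodule A N)))
  rw [← hc]
  exact WithBot.coe_le_coe.mpr (le_add_self (a := (rs.length : ℕ∞)) (b := c))

theorem filterGrade_le_localDepth [Module.Finite R M] (a : Ideal R) {p : PrimeSpectrum R}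
    (hpM : p ∈ support R M) (hp : p ∉ PrimeSpectrum.zeroLocus (a : Set R)) :
    filterGrade a p.asIdeal M ≤ localDepth (Localization.AtPrime p.asIdeal)
      (LocalizedModule p.asIdeal.primeCompl M) := by
  have : Nontrivial (LocalizedModule p.asIdeal.primeCompl M) := hpM
  refine iSup₂_le fun rs ⟨hreg, hmem⟩ => ?_
  have hmem' : ∀ x ∈ rs.map (algebraMap R (Localization.AtPrime p.asIdeal)),
      x ∈ IsLocalRing.maximalIdeal (Localization.AtPrime p.asIdeal) := by
    intro x hx
    obtain ⟨y, hy, rfl⟩ := List.mem_map.mp hx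
    exact (IsLocalization.AtPrime.to_map_mem_maximal_iff _ p.asIdeal y).mpr (hmem y hy)
  have hwreg := (isWeaklyRegular_map_algebraMap_iff (Localization.AtPrime p.asIdeal)
    (LocalizedModule p.asIdeal.primeCompl M) rs).mpr
      (hreg.isWeaklyRegular_localizedModule hp)
  refine le_iSup₂_of_le (rs.map (algebraMap R (Localization.AtPrime p.asIdeal)))
    ⟨.of_isWeaklyRegular_of_mem_maximalIdeal _ hmem' hwreg, hmem'⟩ ?_
  simp

/-- The primes in `Supp M_p` correspond to primes of `Supp M` below `p`, and all primes above `p` lie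
in `Supp M`; chains of the two kinds can be joined at `p`. -/
theorem supportDim_localizedModule_add_le [Module.Finite R M] {p : PrimeSpectrum R}
    (hpM : p ∈ support R M) :
    supportDim (Localization.AtPrime p.asIdeal) (LocalizedModule p.asIdeal.primeCompl M) +
      ringKrullDim (R ⧸ p.asIdeal) ≤ supportDim R M := by
  let A := Localization.AtPrime p.asIdeal
  let N := LocalizedModule p.asIdeal.primeCompl M
  let P : support R M := ⟨p, hpM⟩
  have h1 : supportDim A N ≤ height P := by
    rw [height_eq_krullDim_Iic]
    have hmem (Q : support A N) : PrimeSpectrum.comap (algebraMap R A) Q.1 ∈ support R M := by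
      rw [mem_support_iff_of_finite]
      intro r hr
      refine mem_support_iff_of_finite.mp Q.2 (mem_annihilator.mpr fun z => ?_)
      induction z using LocalizedModule.induction_on with
      | h m s =>
        rw [algebraMap_smul, LocalizedModule.smul'_mk, mem_annihilator.mp hr,
          LocalizedModule.zero_mk]
    have hle (Q : support A N) :
        (⟨PrimeSpectrum.comap (algebraMap R A) Q.1, hmem Q⟩ : support R M) ≤ P := by
      intro r hr
      by_contra hrp
      exact Q.1.2.ne_top (Ideal.eq_top_of_isUnit_mem _ hr
        (IsLocalization.map_units A (⟨r, hrp⟩ : p.asIdeal.primeCompl)))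
    refine krullDim_le_of_strictMono (fun Q => (⟨_, hle Q⟩ : Set.Iic P)) fun Q Q' h => ?_
    refine lt_of_le_of_ne (fun r hr => h.le hr) fun he => h.ne ?_
    exact Subtype.ext (PrimeSpectrum.localization_comap_injective A p.asIdeal.primeCompl
      (congrArg (fun z => z.1.1) he))
  have h2 : ringKrullDim (R ⧸ p.asIdeal) ≤ coheight P := by
    rw [coheight_eq_krullDim_Ici, ringKrullDim_quotient]
    exact krullDim_le_of_strictMono
      (fun q => (⟨⟨q.1, mem_support_mono q.2 hpM⟩, q.2⟩ : Set.Ici P)) fun q q' h => h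
  have : Nonempty (support R M) := ⟨P⟩
  refine (add_le_add h1 h2).trans ?_
  rw [supportDim, krullDim_eq_iSup_height_add_coheight_of_nonempty]
  exact WithBot.coe_le_coe.mpr (le_iSup (fun Q : support R M => height Q + coheight Q) P)

/-- The defining equation at a maximal element of `Supp (M/bM) \ V(a)` bounds `dim M`. -/
theorem IsFModule.supportDim_ne_top [IsNoetherianRing R] [Module.Finite R M] {a b : Ideal R}
    (hM : IsFModule a b M) : supportDim R M ≠ ⊤ := by
  obtain ⟨p, hp, hmax⟩ := WellFounded.has_min
    (InvImage.wf PrimeSpectrum.asIdeal (wellFounded_gt (α := Ideal R))) _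
    (Set.sdiff_nonempty.mpr hM.not_support_subset)
  have hpM : p ∈ support R M := support_subset_of_surjective (Submodule.mkQ _)
    (Submodule.mkQ_surjective _) hp.1
  have : Nontrivial (LocalizedModule p.asIdeal.primeCompl M) := hpM
  obtain ⟨x, hxa, hxp⟩ := Set.not_subset.mp hp.2
  have hdim : ringKrullDim (R ⧸ p.asIdeal) ≤ 1 := by
    refine ringKrullDim_quotient_le_one hxp fun q hq hpq => ?_
    by_contra hxq
    exact hmax ⟨q, hq⟩ ⟨mem_support_mono hpq.le hp.1, fun h => hxq (h hxa)⟩ hpq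
  have hgrade : (filterGrade a p.asIdeal M : WithBot ℕ∞) < ⊤ :=
    (WithBot.coe_le_coe.mpr (filterGrade_le_localDepth a hpM hp.2)).trans_lt <|
      (localDepth_le_supportDim _ _).trans_lt <|
        (supportDim_le_ringKrullDim _ _).trans_lt ringKrullDim_lt_top
  rw [← hM.grade_add_dim p hp]
  refine ((add_le_add_right hdim _).trans_lt ?_).ne
  rw [← WithBot.coe_one, ← WithBot.coe_add]
  refine WithBot.coe_lt_coe.mpr (ENat.add_lt_top.mpr ⟨WithBot.coe_lt_coe.mp hgrade, ?_⟩)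
  exact ENat.one_lt_top

end FilterGrade

open FilterGrade Module in
theorem proposition3p3 {R : Type*} [CommRing R] [IsNoetherianRing R] (a b : Ideal R)
    (M : Type*) [AddCommGroup M] [Module R M] [Module.Finite R M]
    (hM : FilterGrade.IsFModule a b M) (p : PrimeSpectrum R)
    (hp : p ∈ Module.support R (M ⧸ (b • ⊤ : Submodule R M)) \
      PrimeSpectrum.zeroLocus (a : Set R)) :
    FilterGrade.IsCohenMacaulay (Localization.AtPrime p.asIdeal)
      (LocalizedModule p.asIdeal.primeCompl M) := by
  have hpM : p ∈ support R M := support_subset_of_surjective (Submodule.mkQ _)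
    (Submodule.mkQ_surjective _) hp.1
  have hnt : Nontrivial (LocalizedModule p.asIdeal.primeCompl M) := hpM
  refine ⟨inferInstance, hnt, le_antisymm (localDepth_le_supportDim _ _) ?_⟩
  refine le_trans ?_ (WithBot.coe_le_coe.mpr (filterGrade_le_localDepth a hpM hp.2))
  have hle := supportDim_localizedModule_add_le hpM
  have htop := hM.supportDim_ne_top
  rw [← hM.grade_add_dim p hp] at hle htop
  obtain ⟨d, hd⟩ := WithBot.ne_bot_iff_exists.mp
    (supportDim_ne_bot_of_nontrivial (Localization.AtPrime p.asIdeal)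
      (LocalizedModule p.asIdeal.primeCompl M))
  obtain ⟨e, he⟩ := WithBot.ne_bot_iff_exists.mp
    (Order.bot_lt_krullDim (α := PrimeSpectrum (R ⧸ p.asIdeal))).ne'
  rw [ringKrullDim, ← he] at hle htop
  rw [← hd] at hle ⊢
  rw [← WithBot.coe_add] at htop hle
  rw [← WithBot.coe_add, WithBot.coe_le_coe] at hle
  have he' : e ≠ ⊤ := by
    rintro rfl
    exact htop (by simp)
  exact WithBot.coe_le_coe.mpr ((ENat.add_le_add_iff_right he').mp hle)
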